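/- Let $H$ be a Hilbert $C^*$-module over a (not necessarily unital) $C^*$-algebra $\mathfrak A$, let $\mathcal L(H)$ be the $C^*$-algebra of adjointable operators on $H$ with unit $I$, and write $\mathcal R(T)$, $\mathcal N(T)$ for the range and the null space of $T\in\mathcal L(H)$. A submodule $M$ of $H$ is orthogonally complemented if it is closed and $H=M+M^\perp$; then $P_M\in\mathcal L(H)$ denotes the projection of $H$ onto $M$. For $T\in\mathcal L(H)$ let $|T|=(T^*T)^{1/2}$; the polar decomposition of $T$, if it exists, is $T=V|T|$ with $V\in\mathcal L(H)$ a partial isometry such that $\overline{\mathcal R(T^*)}$ is orthogonally complemented and $V^*V=P_{\overline{\mathcal R(T^*)}}$. Let $(P,Q)$ be a quasi-projection pair on $H$, that is, $P\in\mathcal L(H)$ is a projection and $Q\in\mathcal L(H)$ is an idempotent with $$PQ^*P=PQP,\qquad PQ^*(I-P)=-PQ(I-P),\qquad (I-P)Q^*(I-P)=(I-P)Q(I-P).$$ Put $T_1=P(I-Q)$, $T_2=(I-P)Q$, $H_1=\mathcal R(P)\cap\mathcal R(Q)$ and $H_4=\mathcal N(P)\cap\mathcal N(Q)$. Suppose that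 $(P,Q)$ is semi-harmonious, that is, $T_1$ and $T_2$ both have polar decompositions, and let $T_i=V_i|T_i|$ $(i=1,2)$ be these polar decompositions. Then $V_1+V_2$ is self-adjoint, $H_1$ and $H_4$ are orthogonally complemented in $H$, and for all $\lambda_1,\lambda_2,\lambda_3\in\mathbb C\setminus\{0\}$ the operator $$W=\lambda_1(V_1-V_2)+\lambda_2P_{H_1}+\lambda_3P_{H_4}$$ is invertible in $\mathcal L(H)$ and satisfies both $$W(Q-P_{H_1})W^{-1}=I-P-P_{H_4}\qquad\text{and}\qquad W(P-P_{H_1})W^{-1}=I-Q-P_{H_4}.$$ -/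

import Mathlib

section HilbertModule

variable (A : Type*) {H : Type*} [NonUnitalCStarAlgebra A] [PartialOrder A] [StarOrderedRing A]
  [NormedAddCommGroup H] [NormedSpace ℂ H] [SMul A H] [CStarModule A H]

/-- Vectors of a Hilbert C⋆-module are separated by the `A`-valued inner product. -/
theorem ext_cstar_inner {x y : H} (h : ∀ z : H, inner A z x = inner A z y) : x = y := by
  have h1 : inner A (x - y) (x - y) = 0 := by
    rw [CStarModule.inner_sub_right, h, sub_self]
  exact sub_eq_zero.mp (CStarModule.inner_self.mp h1)

variable (H) in
/-- The algebra `𝓛(H)` of adjointable operators on the Hilbert `A`-module `H`: operators `T` for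
which there is an operator `S` with `⟪T x, y⟫ = ⟪x, S y⟫` for all `x`, `y`. (The adjointable
operators are automatically `A`-linear and bounded.) -/
def adjointable : Subalgebra ℂ (H →L[ℂ] H) where
  carrier := {T | ∃ S : H →L[ℂ] H, ∀ x y : H, inner A (T x) y = inner A x (S y)}
  mul_mem' := by
    rintro T₁ T₂ ⟨S₁, h₁⟩ ⟨S₂, h₂⟩
    exact ⟨S₂ * S₁, fun x y => by simp [h₁, h₂]⟩
  add_mem' := by
    rintro T₁ T₂ ⟨S₁, h₁⟩ ⟨S₂, h₂⟩
    exact ⟨S₁ + S₂, fun x y => by simp [h₁, h₂]⟩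
  algebraMap_mem' c := ⟨star c • 1, fun x y => by
    simp [Algebra.algebraMap_eq_smul_one]⟩

theorem adjointable_exists_adjoint (T : adjointable A H) :
    ∃ S : adjointable A H, ∀ x y : H, inner A (T.1 x) y = inner A x (S.1 y) := by
  obtain ⟨T, S, h⟩ := T
  refine ⟨⟨S, T, fun x y => ?_⟩, h⟩
  rw [← CStarModule.star_inner (A := A) y, ← h, CStarModule.star_inner]

variable {A}

/-- The star of `T` in `𝓛(H)` is its adjoint operator. -/
noncomputable instance adjointableStar : Star (adjointable A H) :=
  ⟨fun T => (adjointable_exists_adjoint A T).choose⟩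

/-- The defining property of the adjoint: `⟪T x, y⟫ = ⟪x, T⋆ y⟫`. -/
theorem adjointable_inner_left (T : adjointable A H) (x y : H) :
    inner A (T.1 x) y = inner A x ((star T).1 y) :=
  (adjointable_exists_adjoint A T).choose_spec x y

theorem adjointable_inner_right (T : adjointable A H) (x y : H) :
    inner A x (T.1 y) = inner A ((star T).1 x) y := by
  rw [← CStarModule.star_inner (A := A) (T.1 y), adjointable_inner_left, CStarModule.star_inner]

/-- Adjoints are unique. -/
theorem adjointable_star_eq {T S : adjointable A H}
    (h : ∀ x y : H, inner A (T.1 x) y = inner A x (S.1 y)) : star T = S := by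
  ext y
  exact ext_cstar_inner A fun x => by rw [← adjointable_inner_left, h]

noncomputable instance adjointableStarRing : StarRing (adjointable A H) where
  star_involutive T := adjointable_star_eq fun x y => (adjointable_inner_right T x y).symm
  star_mul S T := adjointable_star_eq fun x y => by
    simp [adjointable_inner_left]
  star_add S T := adjointable_star_eq fun x y => by
    simp [adjointable_inner_left]

instance adjointableStarModule : StarModule ℂ (adjointable A H) where
  star_smul c T := adjointable_star_eq fun x y => by
    simp [adjointable_inner_left]

instance adjointableCStarRing : CStarRing (adjointable A H) where
  norm_mul_self_le T := by
    have key : ∀ x : H, ‖T.1 x‖ ≤ √‖star T * T‖ * ‖x‖ := fun x => by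
      have h1 : ‖T.1 x‖ ^ 2 ≤ ‖star T * T‖ * ‖x‖ ^ 2 := by
        rw [CStarModule.norm_sq_eq (A := A), adjointable_inner_left]
        calc ‖inner A x ((star T * T).1 x)‖ ≤ ‖x‖ * ‖(star T * T).1 x‖ :=
              CStarModule.norm_inner_le H
          _ ≤ ‖x‖ * (‖star T * T‖ * ‖x‖) := by
              gcongr
              exact (star T * T).1.le_opNorm x
          _ = _ := by ring
      refine le_of_sq_le_sq ?_ (by positivity)
      have h2 : √‖star T * T‖ ^ 2 = ‖star T * T‖ := Real.sq_sqrt (norm_nonneg _)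
      rwa [mul_pow, h2]
    have h2 : ‖T‖ ≤ √‖star T * T‖ := T.1.opNorm_le_bound (Real.sqrt_nonneg _) key
    calc ‖T‖ * ‖T‖ ≤ √‖star T * T‖ * √‖star T * T‖ := by gcongr
      _ = _ := Real.mul_self_sqrt (norm_nonneg _)

instance adjointableCompleteSpace [CompleteSpace H] : CompleteSpace (adjointable A H) := by
  refine Metric.complete_of_cauchySeq_tendsto fun u hu => ?_
  have hu' : CauchySeq fun n => star (u n) := by
    rw [Metric.cauchySeq_iff] at hu ⊢
    intro ε hε
    obtain ⟨N, hN⟩ := hu ε hε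
    refine ⟨N, fun m hm n hn => ?_⟩
    have h1 : ‖star (u m - u n)‖ = ‖u m - u n‖ := norm_star (u m - u n)
    rw [star_sub] at h1
    rw [dist_eq_norm]
    have h2 := hN m hm n hn
    rw [dist_eq_norm] at h2
    exact h1.trans_lt h2
  have c1 : CauchySeq fun n => (u n).1 := uniformContinuous_subtype_val.comp_cauchySeq hu
  have c2 : CauchySeq fun n => (star (u n)).1 := uniformContinuous_subtype_val.comp_cauchySeq hu'
  obtain ⟨T, hT⟩ := cauchySeq_tendsto_of_complete c1
  obtain ⟨S, hS⟩ := cauchySeq_tendsto_of_complete c2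
  have hTS : ∀ x y : H, inner A (T x) y = inner A x (S y) := fun x y => by
    have e1 : Filter.Tendsto (fun n => (u n).1 x) Filter.atTop (nhds (T x)) :=
      ((ContinuousLinearMap.apply ℂ H x).continuous.tendsto T).comp hT
    have e2 : Filter.Tendsto (fun n => (star (u n)).1 y) Filter.atTop (nhds (S y)) :=
      ((ContinuousLinearMap.apply ℂ H y).continuous.tendsto S).comp hS
    have f1 := ((CStarModule.continuous_inner (A := A) (E := H)).tendsto (T x, y)).comp
      (e1.prodMk_nhds tendsto_const_nhds)
    have f2 := ((CStarModule.continuous_inner (A := A) (E := H)).tendsto (x, S y)).comp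
      ((tendsto_const_nhds (x := x)).prodMk_nhds e2)
    refine tendsto_nhds_unique f1 (f2.congr fun n => ?_)
    exact (adjointable_inner_left (u n) x y).symm
  exact ⟨⟨T, S, hTS⟩, tendsto_subtype_rng.mpr hT⟩

/-- `𝓛(H)` is a C⋆-algebra, under the operator norm and the adjoint. -/
noncomputable instance adjointableCStarAlgebra [CompleteSpace H] :
    CStarAlgebra (adjointable A H) where

/-- The order of the C⋆-algebra `𝓛(H)`. -/
noncomputable instance adjointablePartialOrder [CompleteSpace H] :
    PartialOrder (adjointable A H) := CStarAlgebra.spectralOrder _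

instance adjointableStarOrderedRing [CompleteSpace H] :
    StarOrderedRing (adjointable A H) := CStarAlgebra.spectralOrderedRing _

/-- The range `𝓡(T)`. -/
def opRange (T : adjointable A H) : Submodule ℂ H := LinearMap.range (T.1 : H →ₗ[ℂ] H)

/-- The null space `𝓝(T)`. -/
def opKer (T : adjointable A H) : Submodule ℂ H := LinearMap.ker (T.1 : H →ₗ[ℂ] H)

variable (A) in
/-- `M^⊥ = {x | ⟪x, y⟫ = 0 for every y ∈ M}`. -/
def orthCompl (M : Submodule ℂ H) : Submodule ℂ H where
  carrier := {x | ∀ y ∈ M, inner A x y = 0}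
  add_mem' hx hy z hz := by simp [hx z hz, hy z hz]
  zero_mem' z _ := by simp
  smul_mem' c x hx z hz := by simp [hx z hz]

variable (A) in
/-- `M` is closed and orthogonally complemented in `H`: `H = M + M^⊥`. (Such an `M` is
automatically an `A`-submodule, as it equals `M^⊥⊥`.) -/
structure IsOrthComplemented (M : Submodule ℂ H) : Prop where
  isClosed : IsClosed (M : Set H)
  sup_eq_top : M ⊔ orthCompl A M = ⊤

/-- An orthogonally complemented `M` is the range of exactly one projection in `𝓛(H)`. -/
theorem IsOrthComplemented.existsUnique_proj {M : Submodule ℂ H}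
    (h : IsOrthComplemented A M) :
    ∃! P : adjointable A H, IsStarProjection P ∧ opRange P = M := by
  have hdec : ∀ x : H, ∃ m ∈ M, x - m ∈ orthCompl A M := fun x => by
    obtain ⟨m, hm, n, hn, e⟩ := Submodule.mem_sup.mp (h.sup_eq_top ▸ Submodule.mem_top (x := x))
    exact ⟨m, hm, by rwa [← e, add_sub_cancel_left]⟩
  choose f hf hf' using hdec
  have huniq : ∀ x m, m ∈ M → x - m ∈ orthCompl A M → f x = m := fun x m hm hm' => by
    have h1 : f x - m ∈ M := M.sub_mem (hf x) hm
    have h2 : f x - m ∈ orthCompl A M := by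
      have := (orthCompl A M).sub_mem hm' (hf' x)
      simpa using this
    exact sub_eq_zero.mp ((CStarModule.inner_self (A := A)).mp (h2 _ h1))
  have hadj : ∀ x y, inner A (f x) y = inner A x (f y) := fun x y => by
    have h1 : inner A (f x) (y - f y) = 0 := by
      rw [← CStarModule.star_inner (A := A), hf' y _ (hf x), star_zero]
    have h2 := hf' x _ (hf y)
    rw [CStarModule.inner_sub_right, sub_eq_zero] at h1
    rw [CStarModule.inner_sub_left, sub_eq_zero] at h2
    rw [h1, h2]
  let g : H →ₗ[ℂ] H :=
    { toFun := f
      map_add' := fun x y => huniq _ _ (M.add_mem (hf x) (hf y)) (by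
        have := (orthCompl A M).add_mem (hf' x) (hf' y)
        rwa [add_sub_add_comm])
      map_smul' := fun c x => huniq _ _ (M.smul_mem c (hf x)) (by
        have := (orthCompl A M).smul_mem c (hf' x)
        rwa [smul_sub] at this) }
  have hbound : ∀ x, ‖g x‖ ≤ 1 * ‖x‖ := fun x => by
    have hg : ‖f x‖ * ‖f x‖ ≤ ‖f x‖ * ‖x‖ := by
      have h2 := hf' x _ (hf x)
      rw [CStarModule.inner_sub_left, sub_eq_zero] at h2
      calc ‖f x‖ * ‖f x‖ = ‖inner A (f x) (f x)‖ := by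
            rw [← CStarModule.norm_sq_eq (A := A), sq]
        _ = ‖inner A x (f x)‖ := by rw [h2]
        _ ≤ ‖x‖ * ‖f x‖ := CStarModule.norm_inner_le H
        _ = _ := mul_comm _ _
    rw [one_mul]
    rcases (norm_nonneg (f x)).eq_or_lt with h0 | h0
    · exact h0 ▸ norm_nonneg x
    · exact le_of_mul_le_mul_left hg h0
  let p : H →L[ℂ] H := g.mkContinuous 1 hbound
  have hfix : ∀ m ∈ M, f m = m := fun m hm => huniq m m hm (by simp)
  refine ⟨⟨p, p, hadj⟩, ⟨⟨?_, adjointable_star_eq hadj⟩, ?_⟩, ?_⟩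
  · ext x
    exact hfix _ (hf x)
  · ext x
    constructor
    · rintro ⟨y, rfl⟩
      exact hf y
    · exact fun hx => ⟨x, hfix x hx⟩
  · rintro P ⟨hP, hPM⟩
    ext x
    refine (huniq x (P.1 x) (hPM ▸ ⟨x, rfl⟩) fun y hy => ?_).symm
    rw [← hPM] at hy
    obtain ⟨z, rfl⟩ := hy
    have hPP : P.1 (P.1 x) = P.1 x := congrArg (fun T : adjointable A H => T.1 x) hP.1.eq
    change inner A (x - P.1 x) (P.1 z) = 0
    rw [adjointable_inner_right, hP.2.star_eq, map_sub, hPP, sub_self, CStarModule.inner_zero_left]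

/-- The projection `P_M` of `H` onto an orthogonally complemented `M`. -/
noncomputable def orthProj {M : Submodule ℂ H} (h : IsOrthComplemented A M) : adjointable A H :=
  h.existsUnique_proj.exists.choose

theorem orthProj_spec {M : Submodule ℂ H} (h : IsOrthComplemented A M) :
    IsStarProjection (orthProj h) ∧ opRange (orthProj h) = M :=
  h.existsUnique_proj.exists.choose_spec

/-- `T = V|T|` is the polar decomposition of `T`: `V` is a partial isometry with
`V⋆V = P_{closure of 𝓡(T⋆)}`; here `|T| = (T⋆T)^(1/2)` is `CFC.abs T`. -/
def IsPolarDecomposition [CompleteSpace H] (T V : adjointable A H) : Prop :=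
  T = V * CFC.abs T ∧ V * star V * V = V ∧
    ∃ h : IsOrthComplemented A (opRange (star T)).topologicalClosure, star V * V = orthProj h

/-- `(P, Q)` is a quasi-projection pair. -/
structure IsQuasiProjectionPair (P Q : adjointable A H) : Prop where
  isStarProjection : IsStarProjection P
  isIdempotentElem : IsIdempotentElem Q
  corner₁₁ : P * star Q * P = P * Q * P
  corner₁₂ : P * star Q * (1 - P) = -(P * Q * (1 - P))
  corner₂₂ : (1 - P) * star Q * (1 - P) = (1 - P) * Q * (1 - P)

/-- `T₁ = P(I - Q)`. -/
def opT₁ (P Q : adjointable A H) : adjointable A H := P * (1 - Q)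

/-- `T₂ = (I - P)Q`. -/
def opT₂ (P Q : adjointable A H) : adjointable A H := (1 - P) * Q

/-- `H₁ = 𝓡(P) ∩ 𝓡(Q)`. -/
def subH₁ (P Q : adjointable A H) : Submodule ℂ H := opRange P ⊓ opRange Q

/-- `H₄ = 𝓝(P) ∩ 𝓝(Q)`. -/
def subH₄ (P Q : adjointable A H) : Submodule ℂ H := opKer P ⊓ opKer Q

/-- A quasi-projection pair is semi-harmonious if `T₁` and `T₂` both have the polar
decomposition. -/
structure IsSemiHarmonious [CompleteSpace H] (P Q : adjointable A H) : Prop where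
  isQuasiProjectionPair : IsQuasiProjectionPair P Q
  polar₁ : ∃ V : adjointable A H, IsPolarDecomposition (opT₁ P Q) V
  polar₂ : ∃ V : adjointable A H, IsPolarDecomposition (opT₂ P Q) V

end HilbertModule

/-! Write `J = 2P - 1`. The three corner conditions say exactly `star Q = J Q J`, so `J Q` is
self-adjoint, and so is `S = T₁ + T₂ = P - J Q` (`symbol`), with `J S = P - Q`. Since `T₁` and `T₂`
have orthogonal ranges, `K = T₁ V₁⋆ + T₂ V₂⋆` (`modulus`) is nonnegative with `K² = T₁T₁⋆ + T₂T₂⋆ =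
(P - Q)² m`, where `m = 2(P - Q)² - 1` (`weight`). The square of a difference of idempotents
commutes with both, hence so does `K²`, hence so does its square root `K`.

With `U = V₁ + V₂` one has `K U = S`, and `K` can be cancelled on the left up to the projection `e =
V₁V₁⋆ + V₂V₂⋆` (`modulus_cancel`). Facts about `S` therefore pass to `U`: self-adjointness
(`star_sum`) and `S Q = (1 - P) S` (`sum_mul_right`). Likewise `X = V₁ - V₂ = J U` satisfies `K X =
P - Q`, so `K² X² m = (P - Q)² m = K²` and `X² m = e`: thus `X m` inverts `X` on the range of `e`
even when `P - Q` has no closed range.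

The complement of `e` splits as `(P - V₁V₁⋆) + (1 - P - V₂V₂⋆)`, the projections onto `H₁` and `H₄`.
`W` is block diagonal for this splitting, and the conjugations reduce to `X Q = (1 - P) X` and `X P
= (1 - Q) X`. All but the identification of `H₁` and `H₄` is algebra in a C⋆-algebra. -/

section PolarAlgebra

/-! ### Polar decompositions in a C⋆-algebra. -/

variable {R : Type*} [CStarAlgebra R] [PartialOrder R] [StarOrderedRing R]

/-- The algebraic content of a polar decomposition `t = v|t|` in a C⋆-algebra. -/
structure IsPolarPair (t v : R) : Prop where
  eq_mul_abs : t = v * CFC.abs t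
  partialIsometry : v * star v * v = v
  mul_source : t * (star v * v) = t
  cancel : ∀ x, t * x = 0 → v * x = 0

/-- Whatever commutes with the square of a nonnegative element commutes with the element. -/
theorem Commute.of_mul_self_of_nonneg {k x : R} (hk : 0 ≤ k) (h : Commute (k * k) x) :
    Commute k x := by
  have h1 : CFC.sqrt (k * k) = k := CFC.sqrt_mul_self k hk
  rw [← h1, CFC.sqrt_eq_cfc]
  exact h.cfc_nnreal _

namespace IsPolarPair

variable {t v : R}

theorem star_mul_star (h : IsPolarPair t v) : star v * v * star v = star v := by
  have := congrArg star h.partialIsometry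
  simpa [mul_assoc] using this

theorem star_eq (h : IsPolarPair t v) : star t = CFC.abs t * star v := by
  conv_lhs => rw [h.eq_mul_abs]
  rw [star_mul, (CFC.abs_nonneg t).isSelfAdjoint.star_eq]

theorem mul_star_nonneg (h : IsPolarPair t v) : 0 ≤ t * star v := by
  conv_rhs => rw [h.eq_mul_abs]
  exact star_right_conjugate_nonneg (CFC.abs_nonneg t) v

theorem star_source_mul (h : IsPolarPair t v) : star v * v * star t = star t := by
  have := congrArg star h.mul_source
  simpa [mul_assoc] using this

theorem mul_star_comm (h : IsPolarPair t v) : v * star t = t * star v := by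
  have := h.mul_star_nonneg.isSelfAdjoint.star_eq
  simpa using this

/-- `(t v⋆)² = t t⋆`, so that `t v⋆ = |t⋆|`. -/
theorem mul_star_mul_self (h : IsPolarPair t v) : t * star v * (t * star v) = t * star t := by
  calc t * star v * (t * star v) = t * star v * (v * star t) := by rw [h.mul_star_comm]
    _ = t * (star v * v * star t) := by simp only [mul_assoc]
    _ = t * star t := by rw [h.star_source_mul]

/-- Annihilators replace null spaces: `cancel` turns `t v⋆ x = 0` into `v v⋆ x = 0`, and `v⋆ v v⋆ =
v⋆` removes the extra factor. -/
theorem star_cancel (h : IsPolarPair t v) {x : R} (hx : t * star v * x = 0) : star v * x = 0 := by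
  have h1 : v * (star v * x) = 0 := h.cancel _ (by rw [← mul_assoc, hx])
  rw [← h.star_mul_star, mul_assoc, mul_assoc, h1, mul_zero]

theorem star_mul_eq_zero (h : IsPolarPair t v) {x : R} (hx : star t * x = 0) : star v * x = 0 :=
  h.star_cancel (by rw [← h.mul_star_comm, mul_assoc, hx, mul_zero])

/-- Algebraic form of the fact that the range of `v` lies in the closure of the range of `t`: `1 -
e` is annihilated by `t⋆` on the left, hence by `v⋆`. -/
theorem mul_eq_of_mul_eq (h : IsPolarPair t v) {e : R} (he : star e = e) (ht : e * t = t) :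
    e * v = v := by
  have h1 : star v * (1 - e) = 0 := h.star_mul_eq_zero (by
    have := congrArg star ht
    rw [star_mul, he] at this
    rw [mul_sub, this, mul_one, sub_self])
  have h2 := congrArg star h1
  rw [star_mul, star_sub, star_one, he, star_star, star_zero, sub_mul, one_mul, sub_eq_zero] at h2
  exact h2.symm

end IsPolarPair

/-! ### Quasi-projection pairs, their modulus and support. -/

/-- A quasi-projection pair `(p, q)` in a C⋆-algebra together with the partial isometries of the
polar decompositions of `p(1 - q)` and `(1 - p)q`. -/
structure IsQuasiPolar (p q v w : R) : Prop where
  idem : p * p = p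
  star_left : star p = p
  idem_right : q * q = q
  star_right : star q = (2 * p - 1) * q * (2 * p - 1)
  polar_left : IsPolarPair (p * (1 - q)) v
  polar_right : IsPolarPair ((1 - p) * q) w

namespace IsQuasiPolar

variable {p q v w : R}

theorem idem' (h : IsQuasiPolar p q v w) (x : R) : p * (p * x) = p * x := by
  rw [← mul_assoc, h.idem]

theorem idem_right' (h : IsQuasiPolar p q v w) (x : R) : q * (q * x) = q * x := by
  rw [← mul_assoc, h.idem_right]

theorem mul_left (h : IsQuasiPolar p q v w) : p * v = v :=
  h.polar_left.mul_eq_of_mul_eq h.star_left (h.idem' _)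

theorem mul_right (h : IsQuasiPolar p q v w) : p * w = 0 := by
  have := h.polar_right.mul_eq_of_mul_eq (e := 1 - p) (by rw [star_sub, star_one, h.star_left])
    (by simp only [sub_mul, one_mul, mul_sub, h.idem']; abel)
  simpa [sub_mul] using this

theorem star_left_mul (h : IsQuasiPolar p q v w) : star v * p = star v := by
  simpa [h.star_left] using congrArg star h.mul_left

theorem star_right_mul (h : IsQuasiPolar p q v w) : star w * p = 0 := by
  simpa [h.star_left] using congrArg star h.mul_right

theorem star_right_mul_left (h : IsQuasiPolar p q v w) : star w * v = 0 := by
  rw [← h.mul_left, ← mul_assoc, h.star_right_mul, zero_mul]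

theorem star_left_mul_right (h : IsQuasiPolar p q v w) : star v * w = 0 := by
  simpa using congrArg star h.star_right_mul_left

variable (p q v w) in
/-- `|T₁⋆| + |T₂⋆|`. -/
def modulus : R := p * (1 - q) * star v + (1 - p) * q * star w

variable (v w) in
/-- The sum of the final projections of `v` and `w`. -/
def support : R := v * star v + w * star w

variable (p q) in
/-- The sum `T₁ + T₂`. -/
def symbol : R := p * (1 - q) + (1 - p) * q

theorem modulus_nonneg (h : IsQuasiPolar p q v w) : 0 ≤ modulus p q v w :=
  add_nonneg h.polar_left.mul_star_nonneg h.polar_right.mul_star_nonneg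

theorem star_modulus (h : IsQuasiPolar p q v w) : star (modulus p q v w) = modulus p q v w :=
  h.modulus_nonneg.isSelfAdjoint.star_eq

omit [PartialOrder R] [StarOrderedRing R] in
theorem star_support : star (support v w) = support v w := by simp [support]

/-- `symbol p q` equals `p - (2p - 1) q`, and `(2p - 1) q` is self-adjoint by `star_right`. -/
theorem star_symbol (h : IsQuasiPolar p q v w) : star (symbol p q) = symbol p q := by
  simp only [symbol, star_add, star_mul, star_sub, star_one, h.star_left, h.star_right]
  simp only [two_mul, mul_sub, sub_mul, mul_add, add_mul, mul_one, one_mul, mul_assoc, h.idem]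
  abel

/-- The two summands live in the corners of `p` and `1 - p`, so the cross terms vanish and the
square is `T₁T₁⋆ + T₂T₂⋆`; `star_right` turns this into a polynomial in `p` and `q`. -/
theorem modulus_mul_self (h : IsQuasiPolar p q v w) :
    modulus p q v w * modulus p q v w = (p - q) * (p - q) * (2 * ((p - q) * (p - q)) - 1) := by
  have e1 : p * (1 - q) * star v * ((1 - p) * q * star w) = 0 := by
    have : star v * (1 - p) = 0 := by rw [mul_sub, h.star_left_mul, mul_one, sub_self]
    calc _ = p * (1 - q) * (star v * (1 - p)) * (q * star w) := by simp only [mul_assoc]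
      _ = 0 := by rw [this, mul_zero, zero_mul]
  have e2 : (1 - p) * q * star w * (p * (1 - q) * star v) = 0 := by
    calc _ = (1 - p) * q * (star w * p) * ((1 - q) * star v) := by simp only [mul_assoc]
      _ = 0 := by rw [h.star_right_mul, mul_zero, zero_mul]
  rw [modulus, add_mul, mul_add, mul_add, e1, e2, add_zero, zero_add,
    h.polar_left.mul_star_mul_self, h.polar_right.mul_star_mul_self]
  simp only [star_mul, star_sub, star_one, h.star_left, h.star_right]
  simp only [two_mul, mul_sub, sub_mul, mul_add, add_mul, mul_one, one_mul, mul_assoc, h.idem,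
    h.idem', h.idem_right, h.idem_right']
  abel

/-- True of any two idempotents: both products equal `p - p q p`. -/
theorem commute_sq_left (h : IsQuasiPolar p q v w) : Commute ((p - q) * (p - q)) p := by
  simp only [commute_iff_eq, mul_sub, sub_mul, mul_assoc, h.idem, h.idem', h.idem_right]
  abel

theorem commute_sq_right (h : IsQuasiPolar p q v w) : Commute ((p - q) * (p - q)) q := by
  simp only [commute_iff_eq, mul_sub, sub_mul, mul_assoc, h.idem, h.idem_right, h.idem_right']
  abel

variable (p q) in
/-- The element `2(p - q)² - 1`. -/
def weight : R := 2 * ((p - q) * (p - q)) - 1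

omit [PartialOrder R] [StarOrderedRing R] in
theorem commute_sq_weight : Commute ((p - q) * (p - q)) (weight p q) :=
  ((Commute.ofNat_right _ 2).mul_right (Commute.refl _)).sub_right (Commute.one_right _)

theorem weight_commute_left (h : IsQuasiPolar p q v w) : Commute (weight p q) p :=
  ((Commute.ofNat_left 2 _).mul_left h.commute_sq_left).sub_left (Commute.one_left _)

theorem weight_commute_right (h : IsQuasiPolar p q v w) : Commute (weight p q) q :=
  ((Commute.ofNat_left 2 _).mul_left h.commute_sq_right).sub_left (Commute.one_left _)

omit [PartialOrder R] [StarOrderedRing R] in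
theorem commute_symbol {x : R} (hp : Commute x p) (hq : Commute x q) : Commute x (symbol p q) :=
  (hp.mul_right ((Commute.one_right _).sub_right hq)).add_right
    (((Commute.one_right _).sub_right hp).mul_right hq)

theorem modulus_commute (h : IsQuasiPolar p q v w) {x : R}
    (h1 : Commute ((p - q) * (p - q)) x) (h2 : Commute (weight p q) x) :
    Commute (modulus p q v w) x :=
  .of_mul_self_of_nonneg h.modulus_nonneg (by
    rw [h.modulus_mul_self]
    exact h1.mul_left h2)

theorem modulus_commute_left (h : IsQuasiPolar p q v w) : Commute (modulus p q v w) p :=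
  h.modulus_commute h.commute_sq_left h.weight_commute_left

theorem modulus_commute_symbol (h : IsQuasiPolar p q v w) :
    Commute (modulus p q v w) (symbol p q) :=
  h.modulus_commute (commute_symbol h.commute_sq_left h.commute_sq_right)
    (commute_symbol h.weight_commute_left h.weight_commute_right)

theorem modulus_commute_weight (h : IsQuasiPolar p q v w) :
    Commute (modulus p q v w) (weight p q) :=
  h.modulus_commute commute_sq_weight (.refl _)

/-- The cross terms contain `v⋆w = 0` or `w⋆v = 0`, and `t v⋆v = t` recovers each operator from its
modulus. -/
theorem modulus_mul_sum (h : IsQuasiPolar p q v w) : modulus p q v w * (v + w) = symbol p q := by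
  simp only [modulus, symbol, add_mul, mul_add]
  simp only [mul_assoc _ (star v), mul_assoc _ (star w), h.star_right_mul_left,
    h.star_left_mul_right, h.polar_left.mul_source, h.polar_right.mul_source]
  simp

theorem support_mul_sum (h : IsQuasiPolar p q v w) : support v w * (v + w) = v + w := by
  simp only [support, add_mul, mul_add, h.polar_left.partialIsometry,
    h.polar_right.partialIsometry]
  simp [mul_assoc, h.star_right_mul_left, h.star_left_mul_right]

theorem modulus_mul_support (h : IsQuasiPolar p q v w) :
    modulus p q v w * support v w = modulus p q v w := by
  simp only [modulus, support, add_mul, mul_add]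
  have e1 : star v * (v * star v) = star v := by rw [← mul_assoc, h.polar_left.star_mul_star]
  have e2 : star w * (w * star w) = star w := by rw [← mul_assoc, h.polar_right.star_mul_star]
  have e3 : star v * (w * star w) = 0 := by rw [← mul_assoc, h.star_left_mul_right, zero_mul]
  have e4 : star w * (v * star v) = 0 := by rw [← mul_assoc, h.star_right_mul_left, zero_mul]
  simp only [mul_assoc _ (star v), mul_assoc _ (star w), e1, e2, e3, e4, mul_zero, add_zero,
    zero_add]

theorem support_mul_eq_zero (h : IsQuasiPolar p q v w) {x : R} (hx : modulus p q v w * x = 0) :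
    support v w * x = 0 := by
  have pp : p * (1 - p) = 0 := by rw [mul_sub, h.idem, mul_one, sub_self]
  have e1 : p * (1 - q) * star v * x = 0 := by
    -- Multiplying by `p` isolates the `v` summand; the `w` summand lies in the corner of `1 - p`.
    have := congrArg (p * ·) hx
    simp only [modulus, mul_zero, add_mul, mul_add, ← mul_assoc, h.idem, pp, zero_mul,
      add_zero] at this
    exact this
  have e2 : (1 - p) * q * star w * x = 0 := by
    simpa [modulus, add_mul, e1] using hx
  rw [support, add_mul, mul_assoc, mul_assoc, h.polar_left.star_cancel e1,
    h.polar_right.star_cancel e2, mul_zero, mul_zero, add_zero]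

/-- Left cancellation of the modulus, on elements fixed by the support. -/
theorem modulus_cancel (h : IsQuasiPolar p q v w) {x y : R} (hx : support v w * x = x)
    (hy : support v w * y = y) (hxy : modulus p q v w * x = modulus p q v w * y) : x = y := by
  have := h.support_mul_eq_zero (x := x - y) (by rw [mul_sub, hxy, sub_self])
  rwa [mul_sub, hx, hy, sub_eq_zero] at this

theorem support_mul_modulus (h : IsQuasiPolar p q v w) :
    support v w * modulus p q v w = modulus p q v w := by
  simpa [h.star_modulus, star_support] using congrArg star h.modulus_mul_support

theorem support_mul_support (h : IsQuasiPolar p q v w) :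
    support v w * support v w = support v w := by
  have := h.support_mul_eq_zero (x := support v w - 1)
    (by rw [mul_sub, h.modulus_mul_support, mul_one, sub_self])
  rwa [mul_sub, mul_one, sub_eq_zero] at this

theorem support_commute_left (h : IsQuasiPolar p q v w) : Commute (support v w) p := by
  have : p * (v * star v) = v * star v := by rw [← mul_assoc, h.mul_left]
  have h2 : p * (w * star w) = 0 := by rw [← mul_assoc, h.mul_right, zero_mul]
  simp only [commute_iff_eq, support, add_mul, mul_add, mul_assoc, h.star_left_mul,
    h.star_right_mul, this, h2, mul_zero]

/-! ### Transfer from `symbol` to `v + w` by cancelling the modulus. -/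

/-- The modulus commutes with `v + w`. -/
theorem modulus_commute_sum (h : IsQuasiPolar p q v w) : Commute (modulus p q v w) (v + w) := by
  refine h.modulus_cancel ?_ ?_ ?_
  · rw [← mul_assoc, h.support_mul_modulus]
  · rw [← mul_assoc, h.support_mul_sum]
  · rw [h.modulus_mul_sum, ← mul_assoc, h.modulus_mul_sum, h.modulus_commute_symbol.eq]

/-- `v + w` is self-adjoint. -/
theorem star_sum (h : IsQuasiPolar p q v w) : star (v + w) = v + w := by
  set u := v + w with hu
  set e := support v w with he
  have eu : e * u = u := h.support_mul_sum
  have se : star e = e := star_support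
  -- The adjoint of `K u = u K`, where `K u` is the self-adjoint symbol.
  have h1 : modulus p q v w * star u = symbol p q := by
    have := congrArg star h.modulus_commute_sum.eq
    rw [← hu, h.modulus_mul_sum, h.star_symbol, star_mul, h.star_modulus] at this
    exact this.symm
  have h2 : e * star u = u := by
    refine h.modulus_cancel ?_ eu ?_
    · rw [← mul_assoc, h.support_mul_support]
    · rw [← mul_assoc, h.modulus_mul_support, h1, h.modulus_mul_sum]
  have h3 : u * e = star u := by simpa [se] using congrArg star h2
  -- From `e u = u`, `u e = u⋆` and `e u⋆ = u`: `u⋆ = u e = e u e = e u⋆ = u`.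
  rw [← h3, ← eu, mul_assoc, h3, h2, eu]

theorem sum_mul_support (h : IsQuasiPolar p q v w) : (v + w) * support v w = v + w := by
  simpa only [star_mul, h.star_sum, star_support] using congrArg star h.support_mul_sum

theorem sum_mul_right (h : IsQuasiPolar p q v w) : (v + w) * q = w := by
  have h1 : (1 - p) * (v + w) = w := by simp [sub_mul, mul_add, h.mul_left, h.mul_right]
  have h2 : (1 - p) * (v + w) = (v + w) * q := by
    refine h.modulus_cancel ?_ ?_ ?_
    · rw [← mul_assoc, mul_sub, sub_mul, h.support_commute_left.eq, mul_assoc p, mul_one,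
        h.support_mul_sum, sub_mul, one_mul]
    · rw [← mul_assoc, h.support_mul_sum]
    · rw [← mul_assoc, ← mul_assoc, mul_sub, h.modulus_commute_left.eq, mul_one, sub_mul,
        mul_assoc p, h.modulus_mul_sum]
      simp only [symbol, mul_sub, sub_mul, mul_add, add_mul, mul_one, one_mul, mul_assoc, h.idem,
        h.idem', h.idem_right]
      abel
  rw [← h2, h1]

/-! ### Inverting `v - w` on the support. -/

theorem support_commute_weight (h : IsQuasiPolar p q v w) :
    Commute (support v w) (weight p q) := by
  -- The modulus kills `m (1 - e)` because it commutes with `m`, so `e m (1 - e) = 0`; as `m` is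
  -- self-adjoint, the adjoint relation then gives commutation.
  have h1 : support v w * (weight p q) * support v w = support v w * weight p q := by
    have := h.support_mul_eq_zero (x := weight p q * (1 - support v w)) (by
      rw [← mul_assoc, h.modulus_commute_weight.eq, mul_assoc, mul_sub, h.modulus_mul_support,
        mul_one, sub_self, mul_zero])
    rw [mul_sub, mul_sub, mul_one, sub_eq_zero] at this
    rw [mul_assoc, ← this]
  have hw : star (weight p q) = weight p q := by
    have hs : star ((p - q) * (p - q)) = (p - q) * (p - q) := by
      simp only [star_mul, star_sub, h.star_left, h.star_right]
      simp only [two_mul, mul_sub, sub_mul, mul_add, add_mul, mul_one, one_mul, mul_assoc, h.idem,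
        h.idem', h.idem_right, h.idem_right']
      abel
    rw [weight, star_sub, star_mul, hs, star_one, star_ofNat]
    rw [((Commute.ofNat_left 2 ((p - q) * (p - q)))).eq]
  have h2 := congrArg star h1
  simp only [star_mul, star_support, hw] at h2
  rw [commute_iff_eq, ← h1, ← h2, mul_assoc]

theorem weight_commute_sum (h : IsQuasiPolar p q v w) : Commute (weight p q) (v + w) := by
  refine h.modulus_cancel ?_ ?_ ?_
  · rw [← mul_assoc, h.support_commute_weight.eq, mul_assoc, h.support_mul_sum]
  · rw [← mul_assoc, h.support_mul_sum]
  · rw [← mul_assoc, ← mul_assoc, h.modulus_commute_weight.eq, mul_assoc, h.modulus_mul_sum,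
      (commute_symbol h.weight_commute_left h.weight_commute_right).eq]

theorem sub_eq (h : IsQuasiPolar p q v w) : v - w = (2 * p - 1) * (v + w) := by
  simp only [two_mul, sub_mul, mul_add, add_mul, one_mul, h.mul_left, h.mul_right]
  abel

theorem support_mul_sub (h : IsQuasiPolar p q v w) : support v w * (v - w) = v - w := by
  have : Commute (support v w) (2 * p - 1) :=
    ((Commute.ofNat_right _ 2).mul_right h.support_commute_left).sub_right (Commute.one_right _)
  rw [h.sub_eq, ← mul_assoc, this.eq, mul_assoc, h.support_mul_sum]

theorem sub_mul_support (h : IsQuasiPolar p q v w) : (v - w) * support v w = v - w := by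
  rw [h.sub_eq, mul_assoc, h.sum_mul_support]

theorem weight_commute_sub (h : IsQuasiPolar p q v w) : Commute (weight p q) (v - w) := by
  rw [h.sub_eq]
  exact (((Commute.ofNat_right _ 2).mul_right h.weight_commute_left).sub_right
    (Commute.one_right _)).mul_right h.weight_commute_sum

/-- `v - w` is invertible on the support. -/
theorem sub_mul_self_mul_weight (h : IsQuasiPolar p q v w) :
    (v - w) * (v - w) * weight p q = support v w := by
  have hj : Commute (modulus p q v w) (2 * p - 1) :=
    ((Commute.ofNat_right _ 2).mul_right h.modulus_commute_left).sub_right (Commute.one_right _)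
  have hk : modulus p q v w * (v - w) = (2 * p - 1) * symbol p q := by
    rw [h.sub_eq, ← mul_assoc, hj.eq, mul_assoc, h.modulus_mul_sum]
  have hk' : Commute (modulus p q v w) (v - w) := by
    rw [h.sub_eq]
    exact hj.mul_right h.modulus_commute_sum
  have hs : (2 * p - 1) * symbol p q * ((2 * p - 1) * symbol p q) = (p - q) * (p - q) := by
    have : (2 * p - 1) * symbol p q = p - q := by
      simp only [symbol, two_mul, mul_sub, sub_mul, mul_add, add_mul, mul_one, one_mul, h.idem,
        h.idem']
      abel
    rw [this]
  -- The modulus times `v - w` is `p - q`, so both sides equal `(p - q)² m`; two cancellations of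
  -- the modulus then suffice.
  have hK : modulus p q v w * (modulus p q v w * ((v - w) * (v - w) * weight p q)) =
      modulus p q v w * modulus p q v w := by
    have : modulus p q v w * (v - w) * (modulus p q v w * (v - w)) =
        modulus p q v w * (modulus p q v w * ((v - w) * (v - w))) := by
      rw [mul_assoc, ← mul_assoc (v - w), ← hk'.eq, mul_assoc]
    rw [h.modulus_mul_self, ← weight, ← hs, ← hk, this]
    simp only [mul_assoc]
  have fix : support v w * ((v - w) * (v - w) * weight p q) = (v - w) * (v - w) * weight p q := by
    rw [← mul_assoc, ← mul_assoc, h.support_mul_sub]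
  refine h.modulus_cancel fix h.support_mul_support ?_
  refine h.modulus_cancel ?_ ?_ ?_
  · rw [← mul_assoc, h.support_mul_modulus]
  · rw [← mul_assoc, h.support_mul_modulus]
  · rw [hK, h.modulus_mul_support]

theorem reflection_mul_self (h : IsQuasiPolar p q v w) : (2 * p - 1) * (2 * p - 1) = 1 := by
  simp only [two_mul, mul_sub, sub_mul, mul_add, add_mul, mul_one, one_mul, h.idem]
  abel

theorem eq_reflection (h : IsQuasiPolar p q v w) : q = (2 * p - 1) * star q * (2 * p - 1) := by
  have e := h.reflection_mul_self
  calc q = ((2 * p - 1) * (2 * p - 1)) * q * ((2 * p - 1) * (2 * p - 1)) := by simp [e]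
    _ = _ := by rw [h.star_right]; simp only [mul_assoc]

/-! ### The two projections complementary to the support. -/

theorem star_proj_left (h : IsQuasiPolar p q v w) : star (p - v * star v) = p - v * star v := by
  simp [h.star_left]

theorem star_proj_right (h : IsQuasiPolar p q v w) :
    star (1 - p - w * star w) = 1 - p - w * star w := by
  simp [h.star_left]

theorem star_mul_proj_left (h : IsQuasiPolar p q v w) : star v * (p - v * star v) = 0 := by
  rw [mul_sub, h.star_left_mul, ← mul_assoc, h.polar_left.star_mul_star, sub_self]

theorem star_mul_proj_right (h : IsQuasiPolar p q v w) :
    star w * (1 - p - w * star w) = 0 := by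
  rw [mul_sub, mul_sub, h.star_right_mul, ← mul_assoc, h.polar_right.star_mul_star, mul_one,
    sub_zero, sub_self]

theorem left_mul_proj_left (h : IsQuasiPolar p q v w) :
    p * (p - v * star v) = p - v * star v := by
  rw [mul_sub, h.idem, ← mul_assoc, h.mul_left]

theorem left_mul_proj_right (h : IsQuasiPolar p q v w) :
    p * (1 - p - w * star w) = 0 := by
  rw [mul_sub, mul_sub, h.idem, ← mul_assoc, h.mul_right, mul_one, zero_mul, sub_self, sub_self]

/-- `v⋆` annihilates the projection, hence so does `T₁⋆ = |T₁| v⋆`, which acts on it as `1 - q⋆`. -/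
theorem star_right_mul_proj_left (h : IsQuasiPolar p q v w) :
    star q * (p - v * star v) = p - v * star v := by
  have h1 : star (p * (1 - q)) * (p - v * star v) = 0 := by
    rw [h.polar_left.star_eq, mul_assoc, h.star_mul_proj_left, mul_zero]
  rw [star_mul, star_sub, star_one, h.star_left, mul_assoc, h.left_mul_proj_left, sub_mul,
    one_mul, sub_eq_zero] at h1
  exact h1.symm

theorem star_right_mul_proj_right (h : IsQuasiPolar p q v w) :
    star q * (1 - p - w * star w) = 0 := by
  have h1 : star ((1 - p) * q) * (1 - p - w * star w) = 0 := by
    rw [h.polar_right.star_eq, mul_assoc, h.star_mul_proj_right, mul_zero]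
  rwa [star_mul, star_sub, star_one, h.star_left, mul_assoc, sub_mul, one_mul,
    h.left_mul_proj_right, sub_zero] at h1

/-- The reflection `2p - 1` conjugates `q⋆` into `q` and fixes this projection, so the relation for
`q⋆` carries over. -/
theorem right_mul_proj_left (h : IsQuasiPolar p q v w) :
    q * (p - v * star v) = p - v * star v := by
  have hj : (2 * p - 1) * (p - v * star v) = p - v * star v := by
    rw [sub_mul, mul_assoc, h.left_mul_proj_left, one_mul, two_mul, add_sub_cancel_right]
  conv_lhs => rw [h.eq_reflection]
  rw [mul_assoc, hj, mul_assoc, h.star_right_mul_proj_left, hj]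

theorem right_mul_proj_right (h : IsQuasiPolar p q v w) :
    q * (1 - p - w * star w) = 0 := by
  have hj : (2 * p - 1) * (1 - p - w * star w) = -(1 - p - w * star w) := by
    rw [sub_mul, mul_assoc, h.left_mul_proj_right, one_mul, mul_zero, zero_sub]
  conv_lhs => rw [h.eq_reflection]
  rw [mul_assoc, hj, mul_assoc, mul_neg, h.star_right_mul_proj_right, neg_zero, mul_zero]

theorem proj_left_mul_right (h : IsQuasiPolar p q v w) :
    (p - v * star v) * q = p - v * star v := by
  simpa only [star_mul, star_star, h.star_proj_left] using congrArg star h.star_right_mul_proj_left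

theorem proj_right_mul_right (h : IsQuasiPolar p q v w) : (1 - p - w * star w) * q = 0 := by
  simpa only [star_mul, star_star, h.star_proj_right, star_zero] using
    congrArg star h.star_right_mul_proj_right

theorem proj_left_mul_left (h : IsQuasiPolar p q v w) :
    (p - v * star v) * p = p - v * star v := by
  simpa only [star_mul, h.star_left, h.star_proj_left] using congrArg star h.left_mul_proj_left

theorem proj_right_mul_left (h : IsQuasiPolar p q v w) : (1 - p - w * star w) * p = 0 := by
  simpa only [star_mul, h.star_left, h.star_proj_right, star_zero] using
    congrArg star h.left_mul_proj_right

theorem isStarProjection_proj_left (h : IsQuasiPolar p q v w) :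
    IsStarProjection (p - v * star v) :=
  ⟨by rw [IsIdempotentElem, sub_mul, h.left_mul_proj_left, mul_assoc, h.star_mul_proj_left,
    mul_zero, sub_zero], h.star_proj_left⟩

theorem isStarProjection_proj_right (h : IsQuasiPolar p q v w) :
    IsStarProjection (1 - p - w * star w) :=
  ⟨by rw [IsIdempotentElem, sub_mul, sub_mul, h.left_mul_proj_right, mul_assoc,
    h.star_mul_proj_right, mul_zero, sub_zero, sub_zero, one_mul], h.star_proj_right⟩

theorem proj_left_mul_proj_right (h : IsQuasiPolar p q v w) :
    (p - v * star v) * (1 - p - w * star w) = 0 := by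
  rw [← h.proj_left_mul_left, mul_assoc, h.left_mul_proj_right, mul_zero]

theorem proj_right_mul_proj_left (h : IsQuasiPolar p q v w) :
    (1 - p - w * star w) * (p - v * star v) = 0 := by
  rw [← h.left_mul_proj_left, ← mul_assoc, h.proj_right_mul_left, zero_mul]

omit [PartialOrder R] [StarOrderedRing R] in
theorem support_eq : support v w = 1 - (p - v * star v) - (1 - p - w * star w) := by
  rw [support]; abel

theorem support_mul_proj_left (h : IsQuasiPolar p q v w) :
    support v w * (p - v * star v) = 0 := by
  rw [support_eq (p := p), sub_mul, sub_mul, h.proj_right_mul_proj_left,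
    h.isStarProjection_proj_left.1.eq, one_mul, sub_self, sub_zero]

theorem support_mul_proj_right (h : IsQuasiPolar p q v w) :
    support v w * (1 - p - w * star w) = 0 := by
  rw [support_eq (p := p), sub_mul, sub_mul, h.proj_left_mul_proj_right,
    h.isStarProjection_proj_right.1.eq, one_mul, sub_zero, sub_self]

theorem proj_left_mul_support (h : IsQuasiPolar p q v w) :
    (p - v * star v) * support v w = 0 := by
  simpa only [star_mul, star_support, h.star_proj_left, star_zero] using
    congrArg star h.support_mul_proj_left

theorem proj_right_mul_support (h : IsQuasiPolar p q v w) :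
    (1 - p - w * star w) * support v w = 0 := by
  simpa only [star_mul, star_support, h.star_proj_right, star_zero] using
    congrArg star h.support_mul_proj_right

/-! ### Intertwining relations and the invertible operator. -/

/-- `(v - w) q = (1 - p) (v - w)`. -/
theorem sub_mul_right (h : IsQuasiPolar p q v w) : (v - w) * q = (1 - p) * (v - w) := by
  rw [h.sub_eq, mul_assoc, h.sum_mul_right]
  simp only [two_mul, mul_sub, sub_mul, mul_add, add_mul, one_mul, h.mul_left, h.mul_right,
    mul_zero]
  abel

/-- `(v - w) p = (1 - q) (v - w)`. -/
theorem sub_mul_left (h : IsQuasiPolar p q v w) : (v - w) * p = (1 - q) * (v - w) := by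
  have e : (2 * p - 1) * (v + w) = v - w := h.sub_eq.symm
  have h1 : (v + w) * q = (1 - p) * (v + w) := by
    rw [h.sum_mul_right]; simp [sub_mul, mul_add, h.mul_left, h.mul_right]
  have h2 : star q * (v + w) = (v + w) * (1 - p) := by
    simpa only [star_mul, h.star_sum, star_sub, star_one, h.star_left] using congrArg star h1
  have h3 : (v + w) * p = (1 - star q) * (v + w) := by
    rw [sub_mul, h2, mul_sub, mul_one, one_mul, sub_sub_cancel]
  have h4 : q * (2 * p - 1) = (2 * p - 1) * star q := by
    conv_lhs => rw [h.eq_reflection]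
    -- The adjoint of `(v + w) q = (1 - p)(v + w)` involves `q⋆`; moving it past the reflection `2p
    -- - 1` restores `q`.
    rw [mul_assoc, h.reflection_mul_self, mul_one]
  rw [← e, mul_assoc, h3, ← mul_assoc, ← mul_assoc, mul_sub, sub_mul 1 q, h4, mul_one, one_mul]

/-- The intertwining operator `c₁ (v - w) + c₂ p₁ + c₃ p₄` and its inverse. -/
theorem exists_unit (h : IsQuasiPolar p q v w) {c₁ c₂ c₃ : ℂ} (h₁ : c₁ ≠ 0) (h₂ : c₂ ≠ 0)
    (h₃ : c₃ ≠ 0) :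
    ∃ u : Rˣ, (u : R) = c₁ • (v - w) + c₂ • (p - v * star v) + c₃ • (1 - p - w * star w) ∧
      u * (q - (p - v * star v)) * ↑u⁻¹ = 1 - p - (1 - p - w * star w) ∧
      u * (p - (p - v * star v)) * ↑u⁻¹ = 1 - q - (1 - p - w * star w) := by
  have a1 := h.right_mul_proj_left
  have a2 := h.right_mul_proj_right
  have a3 := h.proj_left_mul_right
  have a4 := h.proj_right_mul_right
  have a5 := h.left_mul_proj_left
  have a6 := h.left_mul_proj_right
  have a7 := h.proj_left_mul_left
  have a8 := h.proj_right_mul_left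
  have b1 := h.isStarProjection_proj_left.1.eq
  have b2 := h.isStarProjection_proj_right.1.eq
  have b3 := h.proj_left_mul_proj_right
  have b4 := h.proj_right_mul_proj_left
  have d1 : (v - w) * (p - v * star v) = 0 := by
    rw [← h.sub_mul_support, mul_assoc, h.support_mul_proj_left, mul_zero]
  have d2 : (v - w) * (1 - p - w * star w) = 0 := by
    rw [← h.sub_mul_support, mul_assoc, h.support_mul_proj_right, mul_zero]
  have d3 : (p - v * star v) * (v - w) = 0 := by
    rw [← h.support_mul_sub, ← mul_assoc, h.proj_left_mul_support, zero_mul]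
  have d4 : (1 - p - w * star w) * (v - w) = 0 := by
    rw [← h.support_mul_sub, ← mul_assoc, h.proj_right_mul_support, zero_mul]
  have s1 := h.sub_mul_self_mul_weight
  have s2 := h.weight_commute_sub
  have r1 := h.sub_mul_right
  have r2 := h.sub_mul_left
  have hs := support_eq (p := p) (v := v) (w := w)
  generalize p - v * star v = p₁ at *
  generalize 1 - p - w * star w = p₄ at *
  generalize v - w = x at *
  generalize weight p q = m at *
  have s3 : x * (x * m) = 1 - p₁ - p₄ := by rw [← mul_assoc, s1, hs]
  have s4 : x * m * x = 1 - p₁ - p₄ := by rw [mul_assoc, s2.eq, s3]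
  have d5 : x * m * p₁ = 0 := by rw [← s2.eq, mul_assoc, d1, mul_zero]
  have d6 : x * m * p₄ = 0 := by rw [← s2.eq, mul_assoc, d2, mul_zero]
  have d7 : p₁ * (x * m) = 0 := by rw [← mul_assoc, d3, zero_mul]
  have d8 : p₄ * (x * m) = 0 := by rw [← mul_assoc, d4, zero_mul]
  let u : Rˣ :=
    { val := c₁ • x + c₂ • p₁ + c₃ • p₄
      -- Blockwise inverse: `x m` inverts `x` on the complement of `p₁ + p₄`, since `x² m = 1 - p₁ -
      -- p₄` and `m` commutes with `x`.
      inv := c₁⁻¹ • (x * m) + c₂⁻¹ • p₁ + c₃⁻¹ • p₄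
      val_inv := by
        simp only [mul_add, add_mul, smul_mul_smul_comm, s3, d1, d2, d7, d8, b1, b2, b3, b4,
          mul_inv_cancel₀ h₁, mul_inv_cancel₀ h₂, mul_inv_cancel₀ h₃, smul_zero, one_smul]
        abel
      inv_val := by
        simp only [mul_add, add_mul, smul_mul_smul_comm, s4, d3, d4, d5, d6, b1, b2, b3, b4,
          inv_mul_cancel₀ h₁, inv_mul_cancel₀ h₂, inv_mul_cancel₀ h₃, smul_zero, one_smul]
        abel }
  refine ⟨u, rfl, ?_, ?_⟩
  · rw [Units.mul_inv_eq_iff_eq_mul]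
    change (c₁ • x + c₂ • p₁ + c₃ • p₄) * _ = _ * (c₁ • x + c₂ • p₁ + c₃ • p₄)
    simp only [mul_add, add_mul, mul_sub, sub_mul, smul_mul_assoc, mul_smul_comm, r1, a3, a4, a5,
      a6, b1, b2, b4, d1, d4, one_mul, smul_zero, sub_zero, sub_self, smul_sub, add_zero]
    abel
  · rw [Units.mul_inv_eq_iff_eq_mul]
    change (c₁ • x + c₂ • p₁ + c₃ • p₄) * _ = _ * (c₁ • x + c₂ • p₁ + c₃ • p₄)
    simp only [mul_add, add_mul, mul_sub, sub_mul, smul_mul_assoc, mul_smul_comm, r2, a1, a2, a7,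
      a8, b1, b2, b4, d1, d4, one_mul, smul_zero, sub_zero, sub_self, smul_sub, add_zero]
    abel

end IsQuasiPolar

end PolarAlgebra

/-! ### Back to Hilbert modules: projections, polar decompositions, `H₁` and `H₄`. -/

section HilbertModule

variable {A H : Type*} [NonUnitalCStarAlgebra A] [PartialOrder A] [StarOrderedRing A]
  [NormedAddCommGroup H] [NormedSpace ℂ H] [SMul A H] [CStarModule A H]

/-- The range of a projection is orthogonally complemented. -/
theorem IsStarProjection.isOrthComplemented {E : adjointable A H} (hE : IsStarProjection E) :
    IsOrthComplemented A (opRange E) := by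
  have hEE : ∀ x, E.1 (E.1 x) = E.1 x := fun x =>
    congrArg (fun T : adjointable A H => T.1 x) hE.1.eq
  refine ⟨?_, ?_⟩
  · have : (opRange E : Set H) = {x | E.1 x = x} := by
      ext x
      constructor
      · rintro ⟨y, rfl⟩
        exact hEE y
      · exact fun hx => ⟨x, hx⟩
    rw [this]
    exact isClosed_eq E.1.continuous continuous_id
  · rw [eq_top_iff]
    intro x _
    refine Submodule.mem_sup.mpr ⟨E.1 x, ⟨x, rfl⟩, x - E.1 x, ?_, by abel⟩
    rintro _ ⟨z, rfl⟩
    change inner A (x - E.1 x) (E.1 z) = 0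
    rw [adjointable_inner_right, hE.2.star_eq, map_sub, hEE, sub_self, CStarModule.inner_zero_left]

theorem orthProj_eq {M : Submodule ℂ H} (h : IsOrthComplemented A M) {E : adjointable A H}
    (hE : IsStarProjection E) (hM : opRange E = M) : orthProj h = E :=
  h.existsUnique_proj.unique (orthProj_spec h) ⟨hE, hM⟩

variable [CompleteSpace H]

/-- The partial isometry of a polar decomposition of `T` vanishes on the null space of `T`. -/
theorem IsPolarDecomposition.apply_eq_zero {T V : adjointable A H} (h : IsPolarDecomposition T V)
    {x : H} (hx : T.1 x = 0) : V.1 x = 0 := by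
  obtain ⟨-, hV, hM, hP⟩ := h
  -- A null vector of `T` is orthogonal to the range of `T⋆` and, by continuity, to its closure,
  -- onto which `V⋆V` projects.
  have h1 : ∀ y ∈ (opRange (star T)).topologicalClosure, inner A x y = 0 := by
    have hc : IsClosed {y : H | inner A x y = 0} :=
      isClosed_eq ((CStarModule.continuous_inner (A := A) (E := H)).comp
        (continuous_const.prodMk continuous_id)) continuous_const
    refine fun y hy => closure_minimal ?_ hc hy
    rintro _ ⟨z, rfl⟩
    change inner A x ((star T).1 z) = 0
    rw [← adjointable_inner_left, hx, CStarModule.inner_zero_left]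
  have h2 : (star V * V).1 x = 0 := by
    refine ext_cstar_inner A fun z => ?_
    have h3 : (star V * V).1 z ∈ (opRange (star T)).topologicalClosure := by
      rw [← (orthProj_spec hM).2, ← hP]
      exact ⟨z, rfl⟩
    have hs : star (star V * V) = star V * V := by simp
    rw [adjointable_inner_right, hs, ← CStarModule.star_inner, h1 _ h3, star_zero,
      CStarModule.inner_zero_right]
  rw [← hV, mul_assoc]
  change V.1 ((star V * V).1 x) = 0
  rw [h2, map_zero]

theorem IsPolarDecomposition.isPolarPair {T V : adjointable A H}
    (h : IsPolarDecomposition T V) : IsPolarPair T V where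
  eq_mul_abs := h.1
  partialIsometry := h.2.1
  mul_source := by
    obtain ⟨-, hV, hM, hP⟩ := h
    have h1 : star V * V * star T = star T := by
      ext x
      have hx : (star T).1 x ∈ opRange (star V * V) := by
        rw [hP, (orthProj_spec hM).2]
        exact Submodule.le_topologicalClosure _ ⟨x, rfl⟩
      obtain ⟨y, hy⟩ := hx
      have hy' : (star V * V).1 y = (star T).1 x := hy
      change (star V * V).1 ((star T).1 x) = (star T).1 x
      rw [← hy']
      have hi : star V * V * (star V * V) = star V * V := by
        rw [mul_assoc, ← mul_assoc V, hV]
      exact congrArg (fun S : adjointable A H => S.1 y) hi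
    simpa [mul_assoc] using congrArg star h1
  cancel X hX := by
    ext x
    exact h.apply_eq_zero (congrArg (fun S : adjointable A H => S.1 x) hX)

/-- `V V⋆` vanishes on the null space of `T⋆`. -/
theorem IsPolarDecomposition.mul_star_apply_eq_zero {T V : adjointable A H}
    (h : IsPolarDecomposition T V) {x : H} (hx : (star T).1 x = 0) : (V * star V).1 x = 0 := by
  refine h.apply_eq_zero (x := (star V).1 x) ?_
  change (T * star V).1 x = 0
  rw [← h.isPolarPair.mul_star_comm]
  change V.1 ((star T).1 x) = 0
  rw [hx, map_zero]

/-- For a quasi-projection pair, `Q⋆ = (2P - 1) Q (2P - 1)`. -/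
theorem IsQuasiProjectionPair.star_eq {P Q : adjointable A H} (h : IsQuasiProjectionPair P Q) :
    star Q = (2 * P - 1) * Q * (2 * P - 1) := by
  have h₁₁ := h.corner₁₁
  have h₁₂ := h.corner₁₂
  have h₂₂ := h.corner₂₂
  -- The fourth corner is the adjoint of the relation for the off-diagonal one.
  have h₂₁ : (1 - P) * star Q * P = -((1 - P) * Q * P) := by
    have := congrArg star h₁₂
    simp only [star_mul, star_neg, star_sub, star_one, star_star,
      h.isStarProjection.2.star_eq, ← mul_assoc] at this
    rw [this, neg_neg]
  calc star Q = P * star Q * P + P * star Q * (1 - P) + (1 - P) * star Q * P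
        + (1 - P) * star Q * (1 - P) := by noncomm_ring
    _ = P * Q * P + -(P * Q * (1 - P)) + -((1 - P) * Q * P) + (1 - P) * Q * (1 - P) := by
        rw [h₁₁, h₁₂, h₂₁, h₂₂]
    _ = _ := by noncomm_ring

theorem isQuasiPolar {P Q V₁ V₂ : adjointable A H} (h : IsQuasiProjectionPair P Q)
    (hV₁ : IsPolarDecomposition (opT₁ P Q) V₁) (hV₂ : IsPolarDecomposition (opT₂ P Q) V₂) :
    IsQuasiPolar P Q V₁ V₂ where
  idem := h.isStarProjection.1.eq
  star_left := h.isStarProjection.2.star_eq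
  idem_right := h.isIdempotentElem.eq
  star_right := h.star_eq
  polar_left := hV₁.isPolarPair
  polar_right := hV₂.isPolarPair

namespace IsQuasiPolar

variable {P Q V₁ V₂ : adjointable A H}

theorem opRange_proj_left (h : IsQuasiPolar P Q V₁ V₂)
    (hV₁ : IsPolarDecomposition (opT₁ P Q) V₁) :
    opRange (P - V₁ * star V₁) = subH₁ P Q := by
  ext x
  constructor
  · rintro ⟨y, rfl⟩
    exact ⟨⟨(P - V₁ * star V₁).1 y,
        congrArg (fun S : adjointable A H => S.1 y) h.left_mul_proj_left⟩,
      ⟨(P - V₁ * star V₁).1 y,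
        congrArg (fun S : adjointable A H => S.1 y) h.right_mul_proj_left⟩⟩
  · rintro ⟨⟨y, hy⟩, ⟨z, hz⟩⟩
    have hP : P.1 x = x := by
      rw [← hy]
      exact congrArg (fun S : adjointable A H => S.1 y) h.idem
    have hQ : Q.1 x = x := by
      rw [← hz]
      exact congrArg (fun S : adjointable A H => S.1 z) h.idem_right
    have hT : star (opT₁ P Q) = P - (P * (Q * P) + P * (Q * P) - Q * P) := by
      rw [opT₁, star_mul, star_sub, star_one, h.star_left, h.star_right]
      simp only [two_mul, sub_mul, add_mul, mul_sub, mul_add, one_mul, mul_one, mul_assoc, h.idem]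
      abel
    -- On a vector fixed by `P` and `Q`, `Q⋆ = (2P - 1) Q (2P - 1)` also acts as the identity, so
    -- `T₁⋆ = (1 - Q⋆) P` kills it, and then so does `V₁V₁⋆`.
    have hx : (star (opT₁ P Q)).1 x = 0 := by
      rw [hT]
      change P.1 x - (P.1 (Q.1 (P.1 x)) + P.1 (Q.1 (P.1 x)) - Q.1 (P.1 x)) = 0
      simp only [hP, hQ]
      abel
    refine ⟨x, ?_⟩
    change P.1 x - (V₁ * star V₁).1 x = x
    rw [hV₁.mul_star_apply_eq_zero hx, hP, sub_zero]

theorem opRange_proj_right (h : IsQuasiPolar P Q V₁ V₂)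
    (hV₂ : IsPolarDecomposition (opT₂ P Q) V₂) :
    opRange (1 - P - V₂ * star V₂) = subH₄ P Q := by
  ext x
  constructor
  · rintro ⟨y, rfl⟩
    exact ⟨congrArg (fun S : adjointable A H => S.1 y) h.left_mul_proj_right,
      congrArg (fun S : adjointable A H => S.1 y) h.right_mul_proj_right⟩
  · rintro ⟨hP, hQ⟩
    replace hP : P.1 x = 0 := hP
    replace hQ : Q.1 x = 0 := hQ
    have hT : star (opT₂ P Q) = Q - (P * Q + P * Q) - (Q - (P * Q + P * Q)) * P := by
      rw [opT₂, star_mul, star_sub, star_one, h.star_left, h.star_right]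
      simp only [two_mul, sub_mul, add_mul, mul_sub, mul_add, one_mul, mul_one, mul_assoc, h.idem]
      abel
    have hx : (star (opT₂ P Q)).1 x = 0 := by
      rw [hT]
      change Q.1 x - (P.1 (Q.1 x) + P.1 (Q.1 x)) - (Q - (P * Q + P * Q)).1 (P.1 x) = 0
      simp only [hP, hQ, map_zero, add_zero, sub_zero]
    refine ⟨x, ?_⟩
    change x - P.1 x - (V₂ * star V₂).1 x = x
    rw [hV₂.mul_star_apply_eq_zero hx, hP, sub_zero, sub_zero]

end IsQuasiPolar
end HilbertModule

theorem mainTheorem3 {A H : Type*} [NonUnitalCStarAlgebra A] [PartialOrder A] [StarOrderedRing A]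
    [NormedAddCommGroup H] [NormedSpace ℂ H] [CompleteSpace H] [SMul A H] [CStarModule A H]
    (P Q : adjointable A H) (hPQ : IsSemiHarmonious P Q)
    (V₁ V₂ : adjointable A H) (hV₁ : IsPolarDecomposition (opT₁ P Q) V₁)
    (hV₂ : IsPolarDecomposition (opT₂ P Q) V₂) :
    IsSelfAdjoint (V₁ + V₂) ∧
    ∃ (h₁ : IsOrthComplemented A (subH₁ P Q)) (h₄ : IsOrthComplemented A (subH₄ P Q)),
      ∀ c₁ c₂ c₃ : ℂ, c₁ ≠ 0 → c₂ ≠ 0 → c₃ ≠ 0 →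
        ∃ W : (adjointable A H)ˣ,
          (W : adjointable A H) = c₁ • (V₁ - V₂) + c₂ • orthProj h₁ + c₃ • orthProj h₄ ∧
          W * (Q - orthProj h₁) * ↑W⁻¹ = 1 - P - orthProj h₄ ∧
          W * (P - orthProj h₁) * ↑W⁻¹ = 1 - Q - orthProj h₄ := by
  have h := isQuasiPolar hPQ.isQuasiProjectionPair hV₁ hV₂
  have r₁ := h.opRange_proj_left hV₁
  have r₄ := h.opRange_proj_right hV₂
  have h₁ : IsOrthComplemented A (subH₁ P Q) :=
    r₁ ▸ h.isStarProjection_proj_left.isOrthComplemented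
  have h₄ : IsOrthComplemented A (subH₄ P Q) :=
    r₄ ▸ h.isStarProjection_proj_right.isOrthComplemented
  refine ⟨h.star_sum, h₁, h₄, fun c₁ c₂ c₃ hc₁ hc₂ hc₃ => ?_⟩
  rw [orthProj_eq h₁ h.isStarProjection_proj_left r₁,
    orthProj_eq h₄ h.isStarProjection_proj_right r₄]
  exact h.exists_unit hc₁ hc₂ hc₃
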